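/- \textbf{Theorem (first-passage percolation domination).} Let $V$ be a countable set of vertices and $\mathcal I$ a countable index set. In a first-passage percolation model on $V$, every directed edge $(x,y)$ with $x\neq y$ in $V$ has a random passage time $W(x,y)\in[0,\infty]$, the passage times of different edges being independent but not necessarily identically distributed, and every vertex $x$ has a deterministic source time $t(x)$. The occupation time of $x\in V$ is $$T(x)=\inf_{y_0,y_1,\dots,y_m:\ y_m=x}\Bigl\{t(y_0)+\sum_{k=1}^m W(y_{k-1},y_k)\Bigr\},$$ where the infimum is over all $m\ge 0$ and all finite sequences of vertices ending at $x$ in which consecutive vertices are distinct. For each $i\in\mathcal I$ let a model with passage times $W_i(x,y)$, source times $t_i(x)\in(-\infty,\infty]$ and occupation times $T_i(x)$ be given. Suppose that the models are independent of each other and that for each edge $(x,y)$ the passage times $W_i(x,y)$, $i\in\mathcal I$, have the same distribution (the source times may differ between models). Let $$\tilde T(x)=\inf_{i\in\mathcal I}T_i(x),\qquad x\in V.$$ Consider a further model, with the same passage time distributions as the others and with source times $t(x)=\inf_{i\in\mathcal I}t_i(x)$, and let $T(x)$ be its occupation times. (If $t(x)=-\infty$ for some $x$, the convention $-\infty+\infty=\infty$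 is used in the formula for the occupation time.) Then $(\tilde T(x))_{x\in V}$ is stochastically dominated by $(T(x))_{x\in V}$: on some probability space there are random functions $(\tilde T'(x))_{x\in V}$ and $(T'(x))_{x\in V}$, equal in law to $(\tilde T(x))_{x\in V}$ and $(T(x))_{x\in V}$ respectively, such that almost surely $\tilde T'(x)\le T'(x)$ for all $x\in V$. -/

import Mathlib

open MeasureTheory ProbabilityTheory
open scoped ENNReal

noncomputable section

/-- `X` stochastically dominates `Y`: there is a coupling `(X', Y')` of the laws of `X` and `Y`,
on some probability space, with `Y' ≤ X'` almost surely. -/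
def StochasticallyDominates.{u, v, w} {Ω₁ : Type u} {Ω₂ : Type v} {E : Type w} [MeasurableSpace Ω₁] [MeasurableSpace Ω₂]
    [MeasurableSpace E] [LE E]
    (X : Ω₁ → E) (P₁ : Measure Ω₁) (Y : Ω₂ → E) (P₂ : Measure Ω₂) : Prop :=
  ∃ (Ω : Type w) (_ : MeasurableSpace Ω) (Q : Measure Ω) (X' Y' : Ω → E),
    IsProbabilityMeasure Q ∧ IdentDistrib X' X Q P₁ ∧ IdentDistrib Y' Y Q P₂ ∧
      ∀ᵐ ω ∂Q, Y' ω ≤ X' ω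

namespace FPP

/-- The directed edges: ordered pairs of distinct vertices. -/
abbrev Edge (V : Type*) : Type _ := {e : V × V // e.1 ≠ e.2}

/-- A finite directed path `y₀, y₁, …, y_m` (with `m ≥ 0`) that ends at `x`; vertices may be
repeated, but consecutive vertices are joined by an edge, so they are distinct. -/
structure VertexPath {V : Type*} (x : V) where
  /-- the number `m` of edges -/
  length : ℕ
  /-- the vertices `y₀, …, y_m` -/
  vertex : Fin (length + 1) → V
  step : ∀ k : Fin length, vertex k.castSucc ≠ vertex k.succ
  vertex_last : vertex (Fin.last length) = x

/-- The total passage time `∑_{k=1}^m w(y_{k-1}, y_k)` along a path. -/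
def VertexPath.passageTime {V : Type*} {x : V} (γ : VertexPath x) (w : Edge V → ℝ≥0∞) : ℝ≥0∞ :=
  ∑ k : Fin γ.length, w ⟨(γ.vertex k.castSucc, γ.vertex k.succ), γ.step k⟩

/-- The sum `s + d` of a starting time `s ∈ [-∞, ∞]` and a duration `d ∈ [0, ∞]`, with the
convention `-∞ + ∞ = ∞`: an infinite passage time is never completed. (In `EReal` the sum
`⊥ + ⊤` is `⊥`.) For `s ≠ -∞` this is the ordinary sum, see `arrivalTime_of_ne_bot`. -/
def arrivalTime (s : EReal) (d : ℝ≥0∞) : EReal :=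
  if d = ⊤ then ⊤ else s + (d : EReal)

theorem arrivalTime_of_ne_bot {s : EReal} (hs : s ≠ ⊥) (d : ℝ≥0∞) :
    arrivalTime s d = s + (d : EReal) := by
  unfold arrivalTime
  split_ifs with h
  · subst h
    simp [EReal.add_top_of_ne_bot hs]
  · rfl

/-- The occupation time of `x`, for source times `t` and passage times `w`: the infimum over all
paths `y₀, …, y_m = x` of `t(y₀) + ∑_{k=1}^m w(y_{k-1}, y_k)`. -/
def occupationTime {V : Type*} (t : V → EReal) (w : Edge V → ℝ≥0∞) (x : V) : EReal :=
  ⨅ γ : VertexPath x, arrivalTime (t (γ.vertex 0)) (γ.passageTime w)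

end FPP

end

/-! The occupation time with source times `⨅ i, t i` is the infimum over `i` of the occupation times
with source times `t i` and one common family of passage times (`FPP.occupationTime_iInf`). Sharing
the passage times must therefore be compared with using independent copies of them.

Restrict to a finite set `J` of models and to paths that leave only vertices of a finite set `U`.
Passage times for the shared model are selected from the independent ones by exploration. Take `x₀ ∈
U` and `i₀ ∈ J` with the smallest source time, let the shared model use the edges out of `x₀` from
model `i₀`, record their effect in the source times of model `i₀`, and continue with `U \ {x₀}`. In
the other models the edges out of `x₀` are discarded, which can only increase their times. In the
shared model nothing is lost, since `x₀` cannot be reached before the minimal source time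
(`FPP.iInf_occupationTimeIn_le_of_relax`). Edges out of `x₀` are read only when `x₀` is explored,
and the choice of model depends only on what was seen before, so the selected times again have the
product law (`FPP.IsDominatingSelection.map_explore`). This gives a pointwise coupling for finite
`U` and `J`.

As `U` and `J` grow, both sides converge pointwise to the true times. Compactness of the probability
measures on pairs of functions `V → EReal` and closedness of the order yield a limiting coupling
(`stochasticallyDominates_of_tendsto`). -/

noncomputable section

namespace FPP

variable {V I : Type*}

/-! ### Arithmetic of arrival times -/

@[simp]
theorem arrivalTime_top_right (s : EReal) : arrivalTime s ⊤ = ⊤ := by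
  simp [arrivalTime]

@[simp]
theorem arrivalTime_zero_right (s : EReal) : arrivalTime s 0 = s := by
  simp [arrivalTime]

theorem arrivalTime_coe (s : EReal) (d : NNReal) : arrivalTime s d = s + ((d : ℝ) : EReal) := by
  simp [arrivalTime]
  rfl

theorem le_arrivalTime_iff (r s : EReal) (d : NNReal) :
    r - ((d : ℝ) : EReal) ≤ s ↔ r ≤ arrivalTime s d := by
  rw [arrivalTime_coe]
  exact EReal.sub_le_iff_le_add (Or.inl (EReal.coe_ne_bot _)) (Or.inl (EReal.coe_ne_top _))

/-- For finite `d`, adding `d` is an upper adjoint. For `d = ⊤` both sides are `⊤` even if the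
infimum is `⊥`, which is where the convention `-∞ + ∞ = ∞` enters. -/
theorem arrivalTime_iInf {ι : Sort*} (s : ι → EReal) (d : ℝ≥0∞) :
    arrivalTime (⨅ i, s i) d = ⨅ i, arrivalTime (s i) d := by
  induction d with
  | top => simp
  | coe d =>
    have : GaloisConnection (fun r : EReal => r - ((d : ℝ) : EReal)) (fun s => arrivalTime s d) :=
      fun r s => le_arrivalTime_iff r s d
    exact this.u_iInf

theorem arrivalTime_mono_left {s s' : EReal} (h : s ≤ s') (d : ℝ≥0∞) :
    arrivalTime s d ≤ arrivalTime s' d := by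
  unfold arrivalTime
  split_ifs
  · exact le_rfl
  · exact add_le_add_left h _

theorem le_arrivalTime (s : EReal) (d : ℝ≥0∞) : s ≤ arrivalTime s d := by
  unfold arrivalTime
  split_ifs
  · exact le_top
  · exact le_add_of_nonneg_right (EReal.coe_ennreal_nonneg d)

theorem arrivalTime_arrivalTime (s : EReal) (d d' : ℝ≥0∞) :
    arrivalTime (arrivalTime s d) d' = arrivalTime s (d + d') := by
  induction d with
  | top => cases d' <;> simp [arrivalTime]
  | coe d =>
    induction d' with
    | top => simp
    | coe d' =>
      rw [← ENNReal.coe_add, arrivalTime_coe, arrivalTime_coe, arrivalTime_coe, add_assoc]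
      simp

theorem measurable_arrivalTime : Measurable fun p : EReal × ℝ≥0∞ => arrivalTime p.1 p.2 := by
  unfold arrivalTime
  refine Measurable.ite (measurable_snd (measurableSet_singleton _)) measurable_const ?_
  exact measurable_fst.add (measurable_coe_ennreal_ereal.comp measurable_snd)

/-! ### Occupation times restricted to finitely many departure vertices -/

/-- The occupation time of `x` when only paths which leave no vertex outside `U` are allowed. -/
def occupationTimeIn (U : Finset V) (t : V → EReal) (w : Edge V → ℝ≥0∞) (x : V) : EReal :=
  ⨅ γ : {γ : VertexPath x // ∀ k : Fin γ.length, γ.vertex k.castSucc ∈ U},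
    arrivalTime (t (γ.1.vertex 0)) (γ.1.passageTime w)

/-- The path without edges. -/
def VertexPath.nil (x : V) : VertexPath x where
  length := 0
  vertex _ := x
  step k := k.elim0
  vertex_last := rfl

/-- The path extended by one edge at its end. -/
def VertexPath.snoc {x y : V} (γ : VertexPath x) (h : x ≠ y) : VertexPath y where
  length := γ.length + 1
  vertex := Fin.snoc γ.vertex y
  step k := by
    induction k using Fin.lastCases with
    | last => simpa [γ.vertex_last, Fin.succ_last] using h
    | cast k =>
      rw [Fin.snoc_castSucc, Fin.succ_castSucc, Fin.snoc_castSucc]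
      exact γ.step k
  vertex_last := Fin.snoc_last ..

theorem VertexPath.vertex_snoc_castSucc {x y : V} (γ : VertexPath x) (h : x ≠ y)
    (k : Fin (γ.length + 1)) : (γ.snoc h).vertex k.castSucc = γ.vertex k :=
  Fin.snoc_castSucc (α := fun _ => V) ..

theorem VertexPath.vertex_snoc_zero {x y : V} (γ : VertexPath x) (h : x ≠ y) :
    (γ.snoc h).vertex 0 = γ.vertex 0 :=
  γ.vertex_snoc_castSucc h 0

theorem VertexPath.passageTime_snoc {x y : V} (γ : VertexPath x) (h : x ≠ y)
    (w : Edge V → ℝ≥0∞) :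
    (γ.snoc h).passageTime w = γ.passageTime w + w ⟨(x, y), h⟩ := by
  refine (Fin.sum_univ_castSucc (n := γ.length) _).trans ?_
  congr 1
  · refine Finset.sum_congr rfl fun k _ => ?_
    congr 3
    · exact γ.vertex_snoc_castSucc h _
    · exact γ.vertex_snoc_castSucc h k.succ
  · congr 3
    · exact (γ.vertex_snoc_castSucc h _).trans γ.vertex_last
    · exact Fin.snoc_last (α := fun _ => V) ..

theorem occupationTimeIn_le (U : Finset V) (t : V → EReal) (w : Edge V → ℝ≥0∞) (x : V) :
    occupationTimeIn U t w x ≤ t x := by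
  refine (iInf_le _ ⟨VertexPath.nil x, fun k => k.elim0⟩).trans ?_
  have : (VertexPath.nil x).passageTime w = 0 := Fin.sum_univ_zero _
  exact (congrArg _ this).trans_le (arrivalTime_zero_right _).le

theorem occupationTimeIn_le_arrivalTime (U : Finset V) (t : V → EReal) (w : Edge V → ℝ≥0∞)
    (e : Edge V) (he : e.1.1 ∈ U) :
    occupationTimeIn U t w e.1.2 ≤ arrivalTime (occupationTimeIn U t w e.1.1) (w e) := by
  unfold occupationTimeIn
  rw [arrivalTime_iInf]
  refine le_iInf fun γ => ?_
  have hγ (k : Fin (γ.1.length + 1)) : (γ.1.snoc e.2).vertex k.castSucc ∈ U := by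
    rw [VertexPath.vertex_snoc_castSucc]
    induction k using Fin.lastCases with
    | last => exact γ.1.vertex_last.symm ▸ he
    | cast k => exact γ.2 k
  refine (iInf_le _ ⟨γ.1.snoc e.2, hγ⟩).trans ?_
  rw [arrivalTime_arrivalTime, VertexPath.vertex_snoc_zero, VertexPath.passageTime_snoc]

theorem le_arrivalTime_sum (t : V → EReal) (w : Edge V → ℝ≥0∞) (f : V → EReal) (U : Finset V)
    (hft : ∀ x, f x ≤ t x)
    (hfw : ∀ e : Edge V, e.1.1 ∈ U → f e.1.2 ≤ arrivalTime (f e.1.1) (w e)) (m : ℕ)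
    (v : Fin (m + 1) → V) (hv : ∀ k : Fin m, v k.castSucc ≠ v k.succ)
    (hU : ∀ k : Fin m, v k.castSucc ∈ U) :
    f (v (Fin.last m)) ≤
      arrivalTime (t (v 0)) (∑ k : Fin m, w ⟨(v k.castSucc, v k.succ), hv k⟩) := by
  induction m with
  | zero => simpa using hft _
  | succ m ih =>
    have := ih (fun k => v k.castSucc) (fun k => hv k.castSucc) (fun k => hU k.castSucc)
    rw [Fin.sum_univ_castSucc, ← arrivalTime_arrivalTime]
    exact (hfw ⟨(_, _), hv (Fin.last m)⟩ (hU _)).trans (arrivalTime_mono_left this _)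

/-- The occupation time is the largest function below the source times that satisfies the
triangle inequality along the allowed edges. -/
theorem le_occupationTimeIn {U : Finset V} {t : V → EReal} {w : Edge V → ℝ≥0∞} {f : V → EReal}
    (hft : ∀ x, f x ≤ t x)
    (hfw : ∀ e : Edge V, e.1.1 ∈ U → f e.1.2 ≤ arrivalTime (f e.1.1) (w e)) (x : V) :
    f x ≤ occupationTimeIn U t w x := by
  refine le_iInf fun γ => ?_
  have := le_arrivalTime_sum t w f U hft hfw γ.1.length γ.1.vertex γ.1.step γ.2
  rwa [γ.1.vertex_last] at this

theorem occupationTimeIn_anti_left {U U' : Finset V} (h : U ⊆ U') (t : V → EReal)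
    (w : Edge V → ℝ≥0∞) (x : V) : occupationTimeIn U' t w x ≤ occupationTimeIn U t w x :=
  le_occupationTimeIn (f := occupationTimeIn U' t w) (fun _ => occupationTimeIn_le ..)
    (fun e he => occupationTimeIn_le_arrivalTime _ _ _ e (h he)) x

theorem iInf_occupationTimeIn (t : V → EReal) (w : Edge V → ℝ≥0∞) (x : V) :
    ⨅ U, occupationTimeIn U t w x = occupationTime t w x := by
  classical
  refine le_antisymm (le_iInf fun γ => ?_) (le_iInf fun U => le_iInf fun γ => ?_)
  · refine (iInf_le _ (Finset.univ.image γ.vertex)).trans ?_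
    exact iInf_le (fun γ : {γ : VertexPath x // ∀ k : Fin γ.length, γ.vertex k.castSucc ∈ _} => arrivalTime (t (γ.1.vertex 0))
      (γ.1.passageTime w)) ⟨γ, fun k => Finset.mem_image_of_mem _ (Finset.mem_univ _)⟩
  · exact iInf_le (fun γ : VertexPath x => arrivalTime (t (γ.vertex 0)) (γ.passageTime w)) γ.1

theorem occupationTimeIn_iInf {ι : Sort*} (U : Finset V) (t : ι → V → EReal)
    (w : Edge V → ℝ≥0∞) (x : V) :
    occupationTimeIn U (fun v => ⨅ i, t i v) w x = ⨅ i, occupationTimeIn U (t i) w x := by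
  unfold occupationTimeIn
  simp_rw [arrivalTime_iInf]
  exact iInf_comm

instance countable_vertexPath [Countable V] (x : V) : Countable (VertexPath x) := by
  let F : VertexPath x → Σ n, (Fin (n + 1) → V) := fun γ => ⟨γ.length, γ.vertex⟩
  refine Function.Injective.countable (f := F) fun γ γ' h => ?_
  cases γ; cases γ'
  simp only [F, Sigma.mk.injEq] at h
  obtain ⟨rfl, h⟩ := h
  cases h
  rfl

theorem VertexPath.measurable_passageTime {x : V} (γ : VertexPath x) :
    Measurable γ.passageTime := by
  unfold VertexPath.passageTime
  fun_prop

theorem measurable_occupationTimeIn [Countable V] (U : Finset V) (t : V → EReal) (x : V) :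
    Measurable fun w => occupationTimeIn U t w x :=
  Measurable.iInf fun γ => measurable_arrivalTime.comp
    (measurable_const.prodMk γ.1.measurable_passageTime)

theorem measurable_occupationTime [Countable V] (t : V → EReal) (x : V) :
    Measurable fun w => occupationTime t w x :=
  Measurable.iInf fun γ => measurable_arrivalTime.comp
    (measurable_const.prodMk γ.measurable_passageTime)

end FPP

/-! ### Splicing product measures and measurable choices -/

theorem measurePreserving_piecewise_infinitePi_prod {K : Type*} {X : K → Type*} [∀ k, MeasurableSpace (X k)]
    (ν : ∀ k, Measure (X k)) [∀ k, IsProbabilityMeasure (ν k)] (S : Set K)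
    [∀ k, Decidable (k ∈ S)] :
    MeasurePreserving (fun q : (∀ k, X k) × (∀ k, X k) => S.piecewise q.1 q.2)
      ((Measure.infinitePi ν).prod (Measure.infinitePi ν)) (Measure.infinitePi ν) := by
  have hm : Measurable fun q : (∀ k, X k) × (∀ k, X k) => S.piecewise q.1 q.2 := by
    refine measurable_pi_lambda _ fun k => ?_
    by_cases hk : k ∈ S <;> simp only [Set.piecewise, hk, if_true, if_false] <;> fun_prop
  refine ⟨hm, Measure.eq_infinitePi _ fun s t ht => ?_⟩
  have hpre : (fun q : (∀ k, X k) × (∀ k, X k) => S.piecewise q.1 q.2) ⁻¹' Set.pi s t =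
      Set.pi (s.filter (· ∈ S) : Finset K) t ×ˢ Set.pi (s.filter (· ∉ S) : Finset K) t := by
    ext q
    simp only [Set.mem_preimage, Set.mem_pi, Finset.mem_coe, Set.mem_prod, Finset.mem_filter]
    constructor
    · intro h
      exact ⟨fun k hk => by simpa [hk.2] using h k hk.1, fun k hk => by simpa [hk.2] using h k hk.1⟩
    · rintro ⟨h₁, h₂⟩ k hk
      by_cases hS : k ∈ S
      · simpa [hS] using h₁ k ⟨hk, hS⟩
      · simpa [hS] using h₂ k ⟨hk, hS⟩
  rw [Measure.map_apply hm (.pi s.countable_toSet fun _ _ => ht _), hpre, Measure.prod_prod,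
    Measure.infinitePi_pi _ fun _ _ => ht _, Measure.infinitePi_pi _ fun _ _ => ht _,
    Finset.prod_filter_mul_prod_filter_not]

theorem exists_measurable_argmin {α : Type*} [Countable α] (S : Finset α) (hS : S.Nonempty) :
    ∃ σ : (α → EReal) → α, (∀ a, MeasurableSet {f | σ f = a}) ∧
      ∀ f, σ f ∈ S ∧ ∀ a ∈ S, f (σ f) ≤ f a := by
  classical
  induction hS using Finset.Nonempty.cons_induction with
  | singleton a => exact ⟨fun _ => a, fun b => MeasurableSet.const _, by simp⟩
  | cons a S ha hS ih =>
    obtain ⟨σ, hσ, hmin⟩ := ih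
    have hm : MeasurableSet {f : α → EReal | f a ≤ ⨅ b ∈ S, f b} := by
      refine measurableSet_le (measurable_pi_apply a) ?_
      exact Measurable.iInf fun b => Measurable.iInf fun _ => measurable_pi_apply b
    refine ⟨fun f => if f a ≤ ⨅ b ∈ S, f b then a else σ f, fun c => ?_, fun f => ?_⟩
    · have : {f : α → EReal | (if f a ≤ ⨅ b ∈ S, f b then a else σ f) = c} =
          ({f | f a ≤ ⨅ b ∈ S, f b} ∩ {f | a = c}) ∪ ({f | f a ≤ ⨅ b ∈ S, f b}ᶜ ∩ {f | σ f = c}) := by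
        ext f
        by_cases h : f a ≤ ⨅ b ∈ S, f b <;>
          simp only [Set.mem_ofPred_eq, Set.mem_union, Set.mem_inter_iff, Set.mem_compl_iff, h,
            if_true, if_false, not_true, not_false_eq_true, true_and, false_and, or_false, false_or]
      rw [this]
      exact (hm.inter (MeasurableSet.const _)).union (hm.compl.inter (hσ c))
    · by_cases h : f a ≤ ⨅ b ∈ S, f b
      · simp only [h, if_true]
        refine ⟨Finset.mem_cons_self .., fun b hb => ?_⟩
        rcases Finset.mem_cons.1 hb with rfl | hb
        · exact le_rfl
        · exact h.trans (iInf₂_le b hb)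
      · simp only [h, if_false]
        refine ⟨Finset.mem_cons_of_mem (hmin f).1, fun b hb => ?_⟩
        rcases Finset.mem_cons.1 hb with rfl | hb
        · refine (le_iInf₂ fun c hc => (hmin f).2 c hc).trans (not_le.1 h).le
        · exact (hmin f).2 b hb

theorem measurable_of_countable_cases {α β γ : Type*} [MeasurableSpace α] [MeasurableSpace β]
    [Countable γ] {σ : α → γ} (hσ : ∀ c, MeasurableSet {a | σ a = c}) {F : γ → α → β}
    (hF : ∀ c, Measurable (F c)) : Measurable fun a => F (σ a) a := by
  intro B hB
  have : (fun a => F (σ a) a) ⁻¹' B = ⋃ c, {a | σ a = c} ∩ F c ⁻¹' B := by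
    ext a
    simp
  rw [this]
  exact MeasurableSet.iUnion fun c => (hσ c).inter (hF c hB)

/-! ### Exploring one vertex -/

namespace FPP

variable {V I : Type*}

theorem occupationTimeIn_congr {U : Finset V} {w w' : Edge V → ℝ≥0∞}
    (h : ∀ e : Edge V, e.1.1 ∈ U → w e = w' e) (t : V → EReal) (x : V) :
    occupationTimeIn U t w x = occupationTimeIn U t w' x :=
  le_antisymm
    (le_occupationTimeIn (f := occupationTimeIn U t w) (fun _ => occupationTimeIn_le ..)
      (fun e he => h e he ▸ occupationTimeIn_le_arrivalTime _ _ _ e he) x)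
    (le_occupationTimeIn (f := occupationTimeIn U t w') (fun _ => occupationTimeIn_le ..)
      (fun e he => h e he ▸ occupationTimeIn_le_arrivalTime _ _ _ e he) x)

open Classical in
/-- The source times after the edges going out of the vertex `x₀` in the model `i₀` have been
explored. -/
def relax (t : I → V → EReal) (x₀ : V) (i₀ : I) (w : Edge V → ℝ≥0∞) (i : I) (y : V) : EReal :=
  if h : i = i₀ ∧ x₀ ≠ y then min (t i y) (arrivalTime (t i x₀) (w ⟨(x₀, y), h.2⟩)) else t i y

theorem relax_le (t : I → V → EReal) (x₀ : V) (i₀ : I) (w : Edge V → ℝ≥0∞) (i : I) (y : V) :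
    relax t x₀ i₀ w i y ≤ t i y := by
  unfold relax
  split_ifs
  · exact min_le_left _ _
  · exact le_rfl

theorem relax_le_arrivalTime (t : I → V → EReal) (i₀ : I) (w : Edge V → ℝ≥0∞) (e : Edge V) :
    relax t e.1.1 i₀ w i₀ e.1.2 ≤ arrivalTime (t i₀ e.1.1) (w e) := by
  rw [relax, dif_pos ⟨rfl, e.2⟩]
  exact min_le_right _ _

theorem le_relax {t : I → V → EReal} {x₀ : V} {i₀ : I} (w : Edge V → ℝ≥0∞) {i : I} {y : V}
    {s : EReal} (h₀ : s ≤ t i₀ x₀) (h : s ≤ t i y) : s ≤ relax t x₀ i₀ w i y := by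
  unfold relax
  split_ifs with hi
  · obtain ⟨rfl, -⟩ := hi
    exact le_min h (h₀.trans (le_arrivalTime _ _))
  · exact h

theorem relax_congr (t : I → V → EReal) (x₀ : V) (i₀ : I) {w w' : Edge V → ℝ≥0∞}
    (h : ∀ e : Edge V, e.1.1 = x₀ → w e = w' e) : relax t x₀ i₀ w = relax t x₀ i₀ w' := by
  ext i y
  unfold relax
  split_ifs
  · rw [h _ rfl]
  · rfl

theorem measurable_relax (x₀ : V) (i₀ : I) :
    Measurable fun p : (I → V → EReal) × (Edge V → ℝ≥0∞) => relax p.1 x₀ i₀ p.2 := by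
  refine measurable_pi_lambda _ fun i => measurable_pi_lambda _ fun y => ?_
  unfold relax
  split_ifs
  · have : Measurable fun p : (I → V → EReal) × (Edge V → ℝ≥0∞) => p.1 i x₀ := by fun_prop
    exact Measurable.min (by fun_prop) (measurable_arrivalTime.comp (this.prodMk (by fun_prop)))
  · fun_prop

/-- If the vertex `x₀` is occupied first in the model `i₀`, then the occupation times can be
computed by exploring the edges going out of `x₀` in this model. -/
theorem iInf_occupationTimeIn_le_of_relax [DecidableEq V] {U : Finset V} {J : Finset I} {x₀ : V}
    {i₀ : I} (hx₀ : x₀ ∈ U) (hi₀ : i₀ ∈ J) {t : I → V → EReal}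
    (hmin : ∀ x ∈ U, ∀ i ∈ J, t i₀ x₀ ≤ t i x) (w : I → Edge V → ℝ≥0∞) (w' : Edge V → ℝ≥0∞)
    (hw' : ∀ e : Edge V, e.1.1 = x₀ → w' e = w i₀ e)
    (h : ∀ x, ⨅ i ∈ J, occupationTimeIn (U.erase x₀) (relax t x₀ i₀ (w i₀) i) (w i) x ≤
      occupationTimeIn (U.erase x₀) (fun v => ⨅ i ∈ J, relax t x₀ i₀ (w i₀) i v) w' x) (x : V) :
    ⨅ i ∈ J, occupationTimeIn U (t i) (w i) x ≤
      occupationTimeIn U (fun v => ⨅ i ∈ J, t i v) w' x := by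
  set t' := relax t x₀ i₀ (w i₀)
  -- For `i = i₀` the relaxed source times already account for one step out of `x₀`. For other `i`
  -- the edges out of `x₀` are simply dropped.
  have h₁ : ∀ i, occupationTimeIn U (t i) (w i) x ≤
      occupationTimeIn (U.erase x₀) (t' i) (w i) x := by
    intro i
    refine le_occupationTimeIn (f := occupationTimeIn U (t i) (w i)) (fun y => ?_)
      (fun e he => occupationTimeIn_le_arrivalTime _ _ _ e (Finset.mem_of_mem_erase he)) x
    simp only [t', relax]
    split_ifs with hi
    · obtain ⟨rfl, hy⟩ := hi
      refine le_min (occupationTimeIn_le ..) ?_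
      exact (occupationTimeIn_le_arrivalTime U (t i) (w i) ⟨(x₀, y), hy⟩ hx₀).trans
        (arrivalTime_mono_left (occupationTimeIn_le ..) _)
    · exact occupationTimeIn_le ..
  refine (iInf₂_mono fun i _ => h₁ i).trans ((h x).trans ?_)
  set s' : V → EReal := fun v => ⨅ i ∈ J, t' i v
  refine le_occupationTimeIn (f := occupationTimeIn (U.erase x₀) s' w')
    (fun y => (occupationTimeIn_le ..).trans (iInf₂_mono fun i _ => relax_le ..)) (fun e he => ?_) x
  by_cases hex : e.1.1 = x₀
  · have hlow : t i₀ x₀ ≤ occupationTimeIn (U.erase x₀) s' w' x₀ := by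
      -- The test function is `⊥` outside `U`: source times there may be smaller than the minimum
      -- over `U`, but no allowed path departs from such a vertex.
      have := le_occupationTimeIn (U := U.erase x₀) (t := s') (w := w')
        (f := fun y => if y ∈ U then t i₀ x₀ else ⊥) (fun y => ?_) (fun e he => ?_) x₀
      · simpa [hx₀] using this
      · split_ifs with hy
        · exact le_iInf₂ fun i hi => le_relax _ le_rfl (hmin y hy i hi)
        · exact bot_le
      · simp only [Finset.mem_of_mem_erase he, if_true]
        split_ifs
        · exact le_arrivalTime _ _
        · exact bot_le
    refine (occupationTimeIn_le ..).trans ((iInf₂_le i₀ hi₀).trans ?_)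
    rw [hw' e hex, hex]
    refine le_trans ?_ (arrivalTime_mono_left hlow _)
    subst hex
    exact relax_le_arrivalTime ..
  · exact occupationTimeIn_le_arrivalTime _ _ _ e (Finset.mem_erase.2 ⟨hex, he⟩)

/-! ### Selections with the product law -/

/-- `Φ` selects, depending on the source times `t`, passage times with the law `∏ μ e` out of the
passage times of independent models in such a way that the occupation times for the selected
passage times dominate the infimum of the occupation times of the models `i ∈ J`. -/
structure IsDominatingSelection (μ : Edge V → Measure ℝ≥0∞) [∀ e, IsProbabilityMeasure (μ e)]
    (J : Finset I) (U : Finset V)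
    (Φ : (I → V → EReal) → (I × Edge V → ℝ≥0∞) → Edge V → ℝ≥0∞) : Prop where
  measurable : Measurable fun p : (I → V → EReal) × (I × Edge V → ℝ≥0∞) => Φ p.1 p.2
  congr : ∀ x ∉ U, ∀ t ω η, (∀ k : I × Edge V, k.2.1.1 ≠ x → ω k = η k) →
    ∀ e : Edge V, e.1.1 ≠ x → Φ t ω e = Φ t η e
  map_eq : ∀ t, (Measure.infinitePi fun k : I × Edge V => μ k.2).map (Φ t) = Measure.infinitePi μ
  le : ∀ t ω x, ⨅ i ∈ J, occupationTimeIn U (t i) (fun e => ω (i, e)) x ≤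
    occupationTimeIn U (fun v => ⨅ i ∈ J, t i v) (Φ t ω) x

theorem measurePreserving_section (μ : Edge V → Measure ℝ≥0∞) [∀ e, IsProbabilityMeasure (μ e)]
    (i : I) : MeasurePreserving (fun (ω : I × Edge V → ℝ≥0∞) e => ω (i, e))
      (Measure.infinitePi fun k : I × Edge V => μ k.2) (Measure.infinitePi μ) :=
  ⟨by fun_prop, Measure.map_infinitePi_infinitePi_of_inj (f := fun e : Edge V => (i, e))
    (P := fun k : I × Edge V => μ k.2) (Prod.mk_right_injective i)⟩

theorem isDominatingSelection_empty (μ : Edge V → Measure ℝ≥0∞) [∀ e, IsProbabilityMeasure (μ e)]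
    (J : Finset I) (i : I) : IsDominatingSelection μ J ∅ fun _ ω e => ω (i, e) where
  measurable := by fun_prop
  congr x _ t ω η h e he := h _ he
  map_eq t := (measurePreserving_section μ i).map_eq
  le t ω x := by
    refine le_occupationTimeIn
      (f := fun x => ⨅ i ∈ J, occupationTimeIn ∅ (t i) (fun e => ω (i, e)) x)
      (fun x => iInf₂_mono fun i _ => occupationTimeIn_le ..) (fun e he => ?_) x
    simp at he

open Classical in
/-- The selection that uses the model `i₀` for the edges going out of `x₀` and then continues
with the selection `Φ`. -/
def explore (Φ : (I → V → EReal) → (I × Edge V → ℝ≥0∞) → Edge V → ℝ≥0∞) (x₀ : V) (i₀ : I)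
    (t : I → V → EReal) (ω : I × Edge V → ℝ≥0∞) (e : Edge V) : ℝ≥0∞ :=
  if e.1.1 = x₀ then ω (i₀, e) else Φ (relax t x₀ i₀ fun e => ω (i₀, e)) ω e

theorem measurable_explore {Φ : (I → V → EReal) → (I × Edge V → ℝ≥0∞) → Edge V → ℝ≥0∞}
    (hΦ : Measurable fun p : (I → V → EReal) × (I × Edge V → ℝ≥0∞) => Φ p.1 p.2) (x₀ : V) (i₀ : I) :
    Measurable fun p : (I → V → EReal) × (I × Edge V → ℝ≥0∞) => explore Φ x₀ i₀ p.1 p.2 := by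
  refine measurable_pi_lambda _ fun e => ?_
  unfold explore
  split_ifs
  · fun_prop
  · have h₁ : Measurable fun p : (I → V → EReal) × (I × Edge V → ℝ≥0∞) =>
        (p.1, fun e => p.2 (i₀, e)) := by fun_prop
    exact (measurable_pi_apply e).comp
      (hΦ.comp (((measurable_relax x₀ i₀).comp h₁).prodMk measurable_snd))

theorem IsDominatingSelection.explore_congr [DecidableEq V] {μ : Edge V → Measure ℝ≥0∞}
    [∀ e, IsProbabilityMeasure (μ e)] {J : Finset I} {U : Finset V} {x₀ : V}
    {Φ : (I → V → EReal) → (I × Edge V → ℝ≥0∞) → Edge V → ℝ≥0∞}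
    (hΦ : IsDominatingSelection μ J (U.erase x₀) Φ) (hx₀ : x₀ ∈ U) (i₀ : I) {x : V} (hx : x ∉ U)
    (t : I → V → EReal) {ω η : I × Edge V → ℝ≥0∞}
    (h : ∀ k : I × Edge V, k.2.1.1 ≠ x → ω k = η k) (e : Edge V) (he : e.1.1 ≠ x) :
    explore Φ x₀ i₀ t ω e = explore Φ x₀ i₀ t η e := by
  have hne : x₀ ≠ x := fun h => hx (h ▸ hx₀)
  unfold explore
  split_ifs with hex
  · exact h _ he
  · rw [relax_congr t x₀ i₀ (w' := fun e => η (i₀, e)) fun e he => h _ (he ▸ hne)]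
    exact hΦ.congr x (fun hxU => hx (Finset.mem_of_mem_erase hxU)) _ _ _ h e he

/-- Draw the edges out of `x₀` and all other edges from two independent copies. By `congr`, the
later selection does not see the former except through the relaxed source times. Its law is the
product law for every fixed choice of source times, so it is independent of the explored edges. -/
theorem IsDominatingSelection.map_explore [DecidableEq V] {μ : Edge V → Measure ℝ≥0∞}
    [∀ e, IsProbabilityMeasure (μ e)] {J : Finset I} {U : Finset V} {x₀ : V}
    {Φ : (I → V → EReal) → (I × Edge V → ℝ≥0∞) → Edge V → ℝ≥0∞}
    (hΦ : IsDominatingSelection μ J (U.erase x₀) Φ) (i₀ : I) (t : I → V → EReal) :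
    (Measure.infinitePi fun k : I × Edge V => μ k.2).map (explore Φ x₀ i₀ t) =
      Measure.infinitePi μ := by
  classical
  have hR := measurePreserving_piecewise_infinitePi_prod (fun k : I × Edge V => μ k.2) {k | k.2.1.1 = x₀}
  have hr := measurePreserving_piecewise_infinitePi_prod μ {e | e.1.1 = x₀}
  have hΦm : Measurable (Function.uncurry fun ω : I × Edge V → ℝ≥0∞ =>
      Φ (relax t x₀ i₀ fun e => ω (i₀, e))) := by
    have h₁ : Measurable fun p : (I × Edge V → ℝ≥0∞) × (I × Edge V → ℝ≥0∞) =>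
        (t, fun e => p.1 (i₀, e)) := by fun_prop
    exact hΦ.measurable.comp (((measurable_relax x₀ i₀).comp h₁).prodMk measurable_snd)
  -- Conditionally on the first copy the second component always has the law `∏ μ e`, so the pair
  -- has the product of these laws.
  have hs := (measurePreserving_section μ i₀).skew_product hΦm
    (Filter.Eventually.of_forall fun ω => hΦ.map_eq _)
  have hm : Measurable (explore Φ x₀ i₀ t) :=
    (measurable_explore hΦ.measurable x₀ i₀).comp (measurable_const.prodMk measurable_id)
  have key : explore Φ x₀ i₀ t ∘ (fun q : (I × Edge V → ℝ≥0∞) × (I × Edge V → ℝ≥0∞) =>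
      Set.piecewise {k | k.2.1.1 = x₀} q.1 q.2) =
      (fun q : (Edge V → ℝ≥0∞) × (Edge V → ℝ≥0∞) => Set.piecewise {e | e.1.1 = x₀} q.1 q.2) ∘
        fun q => (fun e => q.1 (i₀, e), Φ (relax t x₀ i₀ fun e => q.1 (i₀, e)) q.2) := by
    ext q e
    by_cases hex : e.1.1 = x₀
    · simp [explore, Set.piecewise, hex]
    · simp only [explore, Function.comp, Set.piecewise, hex, if_false, Set.mem_ofPred_eq]
      rw [relax_congr t x₀ i₀ (w' := fun e => q.1 (i₀, e)) fun e he => by simp [he]]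
      exact hΦ.congr x₀ (Finset.notMem_erase _ _) _ _ _ (fun k hk => by simp [hk]) e hex
  rw [← hR.map_eq, Measure.map_map hm hR.measurable, key]
  exact (hr.comp hs).map_eq

theorem exists_isDominatingSelection [Countable V] [Countable I] (μ : Edge V → Measure ℝ≥0∞)
    [∀ e, IsProbabilityMeasure (μ e)] (J : Finset I) (hJ : J.Nonempty) (U : Finset V) :
    ∃ Φ, IsDominatingSelection μ J U Φ := by
  classical
  induction U using Finset.strongInduction with
  | H U ih =>
  obtain rfl | hU := U.eq_empty_or_nonempty
  · exact ⟨_, isDominatingSelection_empty μ J hJ.choose⟩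
  obtain ⟨σ, hσ, hmin⟩ := exists_measurable_argmin (U ×ˢ J) (hU.product hJ)
  have : ∀ x, ∃ Φ, x ∈ U → IsDominatingSelection μ J (U.erase x) Φ := fun x => by
    by_cases hx : x ∈ U
    · obtain ⟨Φ, hΦ⟩ := ih _ (Finset.erase_ssubset hx)
      exact ⟨Φ, fun _ => hΦ⟩
    · exact ⟨fun _ _ _ => 0, fun h => absurd h hx⟩
  choose Φ hΦ using this
  let τ : (I → V → EReal) → V × I := fun t => σ fun p => t p.2 p.1
  have hτ (t) : (τ t).1 ∈ U ∧ (τ t).2 ∈ J := Finset.mem_product.1 (hmin fun p => t p.2 p.1).1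
  refine ⟨fun t => explore (Φ (τ t).1) (τ t).1 (τ t).2 t, ?_, ?_, ?_, ?_⟩
  -- Indexing by the subtype `U` leaves only those `Φ x` that are selections, hence measurable;
  -- outside `U` the chosen `Φ x` is arbitrary.
  · let τ' : (I → V → EReal) → U × I := fun t => (⟨(τ t).1, (hτ t).1⟩, (τ t).2)
    refine measurable_of_countable_cases (γ := U × I)
      (σ := fun p : (I → V → EReal) × (I × Edge V → ℝ≥0∞) => τ' p.1)
      (F := fun c p => explore (Φ c.1) c.1 c.2 p.1 p.2) (fun c => ?_)
      fun c => measurable_explore (hΦ c.1 c.1.2).measurable _ _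
    have h₁ : Measurable fun p : (I → V → EReal) × (I × Edge V → ℝ≥0∞) =>
        fun q : V × I => p.1 q.2 q.1 := by fun_prop
    convert! h₁ (hσ (c.1.1, c.2)) using 1
    ext p
    simp [τ', τ, Prod.ext_iff, Subtype.ext_iff]
  · intro x hx t ω η h e he
    exact (hΦ _ (hτ t).1).explore_congr (hτ t).1 _ hx t h e he
  · intro t
    exact (hΦ _ (hτ t).1).map_explore _ t
  · intro t ω x
    refine iInf_occupationTimeIn_le_of_relax (hτ t).1 (hτ t).2
      (fun x hx i hi => (hmin fun p => t p.2 p.1).2 (x, i) (Finset.mk_mem_product hx hi))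
      (fun i e => ω (i, e)) _ (fun e he => by simp [explore, he]) (fun y => ?_) x
    refine ((hΦ _ (hτ t).1).le _ ω y).trans_eq (occupationTimeIn_congr (fun e he => ?_) _ _)
    simp [explore, Finset.ne_of_mem_erase he]

end FPP

/-! ### Weak limits of couplings -/

theorem tendsto_map_probabilityMeasure {Ω E ι : Type*} [MeasurableSpace Ω] [MeasurableSpace E]
    [TopologicalSpace E] [BorelSpace E] (P : ProbabilityMeasure Ω)
    {l : Filter ι} [l.IsCountablyGenerated] {X : Ω → E} {Xn : ι → Ω → E} (hX : Measurable X)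
    (hXn : ∀ n, Measurable (Xn n))
    (h : ∀ ω, Filter.Tendsto (fun n => Xn n ω) l (nhds (X ω))) :
    Filter.Tendsto (fun n => P.map (hXn n).aemeasurable) l (nhds (P.map hX.aemeasurable)) := by
  rw [ProbabilityMeasure.tendsto_iff_forall_integral_tendsto]
  intro f
  have hf {Z : Ω → E} (hZ : Measurable Z) :
      ∫ x, f x ∂(P.map hZ.aemeasurable : Measure E) = ∫ ω, f (Z ω) ∂(P : Measure Ω) :=
    integral_map hZ.aemeasurable f.continuous.measurable.aestronglyMeasurable
  simp only [hf hX, fun n => hf (hXn n)]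
  refine tendsto_integral_filter_of_dominated_convergence (fun _ => ‖f‖) ?_ ?_ ?_ ?_
  · exact .of_forall fun n => (f.continuous.measurable.comp (hXn n)).aestronglyMeasurable
  · exact .of_forall fun n => .of_forall fun ω => f.norm_coe_le_norm _
  · exact integrable_const _
  · exact .of_forall fun ω => (f.continuous.tendsto _).comp (h ω)

theorem identDistrib_of_tendsto {Ω E F ι : Type*} [MeasurableSpace Ω] [MeasurableSpace E]
    [TopologicalSpace E] [BorelSpace E] [HasOuterApproxClosed E] [MeasurableSpace F]
    [TopologicalSpace F] [OpensMeasurableSpace F] {P : Measure Ω} [IsProbabilityMeasure P]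
    {l l' : Filter ι} [l'.NeBot] [l.IsCountablyGenerated] {Z : Ω → E} {Zn : ι → Ω → E}
    (hZm : Measurable Z) (hZnm : ∀ n, Measurable (Zn n))
    (hZ : ∀ ω, Filter.Tendsto (fun n => Zn n ω) l (nhds (Z ω))) (hl : l' ≤ l)
    {ν : ι → ProbabilityMeasure F} {Q : ProbabilityMeasure F}
    (hQ : Filter.Tendsto ν l' (nhds Q)) {π : F → E} (hπ : Continuous π)
    (h : ∀ n, (ν n : Measure F).map π = P.map (Zn n)) :
    IdentDistrib π Z (Q : Measure F) P := by
  refine ⟨hπ.measurable.aemeasurable, hZm.aemeasurable, ?_⟩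
  let P₀ : ProbabilityMeasure Ω := ⟨P, inferInstance⟩
  have h₁ := (tendsto_map_probabilityMeasure P₀ hZm hZnm hZ).mono_left hl
  have h₂ := ProbabilityMeasure.tendsto_map_of_tendsto_of_continuous ν Q hQ hπ
  have h₃ : (fun n => (ν n).map hπ.measurable.aemeasurable) =
      fun n => P₀.map (hZnm n).aemeasurable :=
    funext fun n => Subtype.ext (h n)
  rw [h₃] at h₂
  exact congrArg (fun μ : ProbabilityMeasure E => (μ : Measure E)) (tendsto_nhds_unique h₂ h₁)

theorem stochasticallyDominates_of_tendsto {Ω₁ Ω₂ E ι : Type*} [MeasurableSpace Ω₁]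
    [MeasurableSpace Ω₂] [MeasurableSpace E] [TopologicalSpace E] [BorelSpace E] [CompactSpace E]
    [TopologicalSpace.MetrizableSpace E] [SecondCountableTopology E] [Preorder E]
    [OrderClosedTopology E] {P₁ : Measure Ω₁} [IsProbabilityMeasure P₁] {P₂ : Measure Ω₂}
    [IsProbabilityMeasure P₂] {l : Filter ι} [l.NeBot] [l.IsCountablyGenerated]
    {X : Ω₁ → E} {Xn : ι → Ω₁ → E} {Y : Ω₂ → E} {Yn : ι → Ω₂ → E}
    (hXm : Measurable X) (hXnm : ∀ n, Measurable (Xn n))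
    (hYm : Measurable Y) (hYnm : ∀ n, Measurable (Yn n))
    (hX : ∀ ω, Filter.Tendsto (fun n => Xn n ω) l (nhds (X ω)))
    (hY : ∀ ω, Filter.Tendsto (fun n => Yn n ω) l (nhds (Y ω)))
    (hdom : ∀ n, ∃ ν : ProbabilityMeasure (E × E), (ν : Measure (E × E)).map Prod.fst =
      P₁.map (Xn n) ∧ (ν : Measure (E × E)).map Prod.snd = P₂.map (Yn n) ∧
        ∀ᵐ p ∂(ν : Measure (E × E)), p.2 ≤ p.1) :
    StochasticallyDominates X P₁ Y P₂ := by
  choose ν hν₁ hν₂ hle using hdom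
  -- An ultrafilter finer than `l` replaces the extraction of a convergent subsequence of couplings.
  let G : Ultrafilter ι := Ultrafilter.of l
  have hG : (G : Filter ι) ≤ l := Ultrafilter.of_le l
  obtain ⟨Q, -, hQ⟩ := isCompact_univ.ultrafilter_le_nhds (G.map ν) (by simp)
  replace hQ : Filter.Tendsto ν G (nhds Q) := hQ
  refine ⟨E × E, inferInstance, Q, Prod.fst, Prod.snd, inferInstance,
    identDistrib_of_tendsto hXm hXnm hX hG hQ continuous_fst hν₁,
    identDistrib_of_tendsto hYm hYnm hY hG hQ continuous_snd hν₂, ?_⟩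
  have hclosed : IsClosed {p : E × E | p.2 ≤ p.1} := isClosed_le continuous_snd continuous_fst
  -- Portmanteau: the closed set where the order holds has mass one along the couplings, hence also
  -- in the limit.
  have hlim := ProbabilityMeasure.limsup_measure_closed_le_of_tendsto hQ hclosed
  have hone (n) : (ν n : Measure (E × E)) {p : E × E | p.2 ≤ p.1} = 1 :=
    (prob_compl_eq_zero_iff hclosed.measurableSet).1 (hle n)
  simp only [hone, Filter.limsup_const] at hlim
  exact (prob_compl_eq_zero_iff hclosed.measurableSet).2 (le_antisymm prob_le_one hlim)

/-! ### Approximation by finitely many vertices and models -/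

namespace FPP

variable {V I : Type*}

open Classical in
theorem tendsto_iInf_occupationTimeIn (t : I → V → EReal) (w : I → Edge V → ℝ≥0∞) (i₀ : I)
    (x : V) :
    Filter.Tendsto (fun n : Finset V × Finset I =>
      ⨅ i ∈ insert i₀ n.2, occupationTimeIn n.1 (t i) (w i) x) Filter.atTop
      (nhds (⨅ i, occupationTime (t i) (w i) x)) := by
  have hanti : Antitone (fun n : Finset V × Finset I =>
      ⨅ i ∈ insert i₀ n.2, occupationTimeIn n.1 (t i) (w i) x) := fun n m hnm =>
    le_iInf₂ fun i hi => (iInf₂_le i (Finset.insert_subset_insert _ hnm.2 hi)).trans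
      (occupationTimeIn_anti_left hnm.1 ..)
  convert! tendsto_atTop_iInf hanti using 2
  refine le_antisymm (le_iInf fun n => le_iInf₂ fun i _ => ?_) (le_iInf fun i => ?_)
  · exact (iInf_le _ i).trans ((iInf_occupationTimeIn (t i) (w i) x).symm.trans_le (iInf_le _ n.1))
  · rw [← iInf_occupationTimeIn]
    refine le_iInf fun U => (iInf_le _ (U, {i})).trans ?_
    exact iInf₂_le i (by simp)

theorem measurable_iInf_occupationTime [Countable V] [Countable I] {Ω : Type*}
    [MeasurableSpace Ω] (t : I → V → EReal) {w : I → Ω → Edge V → ℝ≥0∞}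
    (hw : ∀ i, Measurable (w i)) :
    Measurable fun ω x => ⨅ i, occupationTime (t i) (w i ω) x :=
  measurable_pi_lambda _ fun x => Measurable.iInf fun i =>
    (measurable_occupationTime (t i) x).comp (hw i)

theorem measurable_iInf_occupationTimeIn [Countable V] [Countable I] {Ω : Type*}
    [MeasurableSpace Ω] (t : I → V → EReal) {w : I → Ω → Edge V → ℝ≥0∞}
    (hw : ∀ i, Measurable (w i)) (U : Finset V) (J : Finset I) :
    Measurable fun ω x => ⨅ i ∈ J, occupationTimeIn U (t i) (w i ω) x :=
  measurable_pi_lambda _ fun x => Measurable.iInf fun i => Measurable.iInf fun _ =>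
    (measurable_occupationTimeIn U (t i) x).comp (hw i)

theorem occupationTime_iInf {ι : Sort*} (t : ι → V → EReal) (w : Edge V → ℝ≥0∞) (x : V) :
    occupationTime (fun v => ⨅ i, t i v) w x = ⨅ i, occupationTime (t i) w x := by
  unfold occupationTime
  simp_rw [arrivalTime_iInf]
  exact iInf_comm

end FPP

end

theorem theorem4 {V I : Type*} [Countable V] [Countable I]
    {Ω Ω' : Type*} [MeasurableSpace Ω] [MeasurableSpace Ω']
    (P : Measure Ω) [IsProbabilityMeasure P] (P' : Measure Ω') [IsProbabilityMeasure P']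
    -- the models `i ∈ I`: passage times `W i` and source times `t i`
    (W : I → FPP.Edge V → Ω → ℝ≥0∞) (hW : ∀ i e, Measurable (W i e))
    (hW_edges : ∀ i, iIndepFun (W i) P)
    (hW_models : iIndepFun (fun (i : I) (ω : Ω) (e : FPP.Edge V) => W i e ω) P)
    (t : I → V → EReal) (ht : ∀ i x, t i x ≠ ⊥)
    -- the additional model: passage times `W'`
    (W' : FPP.Edge V → Ω' → ℝ≥0∞) (hW' : ∀ e, Measurable (W' e))
    (hW'_edges : iIndepFun W' P')
    -- all models have the same passage time distributions
    (hlaw : ∀ i e, IdentDistrib (W i e) (W' e) P P') :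
    StochasticallyDominates
      (fun (ω : Ω') (x : V) =>
        FPP.occupationTime (fun v => ⨅ i, t i v) (fun e => W' e ω) x) P'
      (fun (ω : Ω) (x : V) =>
        ⨅ i, FPP.occupationTime (t i) (fun e => W i e ω) x) P := by
  classical
  simp_rw [FPP.occupationTime_iInf]
  have hWe (i : I) : Measurable fun ω e => W i e ω := measurable_pi_lambda _ (hW i)
  have hW'e : Measurable fun ω e => W' e ω := measurable_pi_lambda _ hW'
  cases isEmpty_or_nonempty I with
  | inl _ =>
    -- Without models both times are identically `⊤`.
    simp only [iInf_of_empty]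
    refine ⟨V → EReal, inferInstance, Measure.dirac ⊤, fun _ _ => ⊤, fun _ _ => ⊤, inferInstance,
      ?_, ?_, .of_forall fun _ => le_rfl⟩ <;>
    exact ⟨aemeasurable_const, aemeasurable_const, by simp [Measure.map_const]⟩
  | inr _ =>
    obtain ⟨i₀⟩ := ‹Nonempty I›
    let μ : FPP.Edge V → Measure ℝ≥0∞ := fun e => P'.map (W' e)
    have hμ : ∀ e, IsProbabilityMeasure (μ e) :=
      fun e => Measure.isProbabilityMeasure_map (hW' e).aemeasurable
    have hmap : P.map (fun ω (k : I × FPP.Edge V) => W k.1 k.2 ω) =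
        Measure.infinitePi fun k : I × FPP.Edge V => μ k.2 := by
      have h := (iIndepFun_uncurry' hW hW_models hW_edges).map_fun_eq_infinitePi_map
        fun k : I × FPP.Edge V => hW k.1 k.2
      rw [h]
      simp only [(hlaw _ _).map_eq, μ]
    have hmap' : P'.map (fun ω e => W' e ω) = Measure.infinitePi μ :=
      hW'_edges.map_fun_eq_infinitePi_map hW'
    refine stochasticallyDominates_of_tendsto (l := (Filter.atTop : Filter (Finset V × Finset I)))
      -- Inserting `i₀` keeps the set of models nonempty, as the selection requires.
      (Xn := fun n ω x => ⨅ i ∈ insert i₀ n.2, FPP.occupationTimeIn n.1 (t i) (fun e => W' e ω) x)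
      (Yn := fun n ω x => ⨅ i ∈ insert i₀ n.2, FPP.occupationTimeIn n.1 (t i) (fun e => W i e ω) x)
      (FPP.measurable_iInf_occupationTime t fun _ => hW'e) (fun n => FPP.measurable_iInf_occupationTimeIn t (fun _ => hW'e) _ _) (FPP.measurable_iInf_occupationTime t hWe) (fun n => FPP.measurable_iInf_occupationTimeIn t hWe _ _)
      (fun ω => tendsto_pi_nhds.2 fun x => FPP.tendsto_iInf_occupationTimeIn t _ i₀ x)
      (fun ω => tendsto_pi_nhds.2 fun x => FPP.tendsto_iInf_occupationTimeIn t _ i₀ x)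
      fun ⟨U, J⟩ => ?_
    obtain ⟨Φ, hΦ⟩ := FPP.exists_isDominatingSelection μ (insert i₀ J) (by simp) U
    have hWm : Measurable fun ω (k : I × FPP.Edge V) => W k.1 k.2 ω :=
      measurable_pi_lambda _ fun k => hW k.1 k.2
    have hΦm : Measurable (Φ t) := hΦ.measurable.comp (measurable_const.prodMk measurable_id)
    have hsel : Measurable fun ω => Φ t fun k => W k.1 k.2 ω := hΦm.comp hWm
    have hX : Measurable fun (w : FPP.Edge V → ℝ≥0∞) x =>
        ⨅ i ∈ insert i₀ J, FPP.occupationTimeIn U (t i) w x :=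
      FPP.measurable_iInf_occupationTimeIn t (fun _ => measurable_id) U (insert i₀ J)
    have hZ := (hX.comp hsel).prodMk (FPP.measurable_iInf_occupationTimeIn t hWe U (insert i₀ J))
    -- The coupling is the joint law, under `P`, of the times from the selected passage times and
    -- the times of the original models.
    refine ⟨⟨P.map _, Measure.isProbabilityMeasure_map hZ.aemeasurable⟩, ?_, ?_, ?_⟩
    · rw [ProbabilityMeasure.coe_mk, Measure.map_map measurable_fst hZ]
      have h₁ : P.map (fun ω => Φ t fun k => W k.1 k.2 ω) = P'.map (fun ω e => W' e ω) := by
        rw [hmap', ← hΦ.map_eq t, ← hmap, Measure.map_map hΦm hWm]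
        rfl
      have h₂ := congrArg (Measure.map fun w x => ⨅ i ∈ insert i₀ J,
        FPP.occupationTimeIn U (t i) w x) h₁
      rwa [Measure.map_map hX hsel, Measure.map_map hX hW'e] at h₂
    · rw [ProbabilityMeasure.coe_mk, Measure.map_map measurable_snd hZ]
      rfl
    · rw [ProbabilityMeasure.coe_mk, ae_map_iff hZ.aemeasurable
        (isClosed_le continuous_snd continuous_fst).measurableSet]
      refine .of_forall fun ω x => ?_
      have h := hΦ.le t (fun k => W k.1 k.2 ω) x
      simp only [FPP.occupationTimeIn_iInf] at h
      exact h
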